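/- Let $\mathcal H$ be a separable complex Hilbert space and let $\mathcal A$ be a CDCSL algebra on $\mathcal H$: a unital algebra of bounded operators that is reflexive (it contains every bounded operator leaving invariant all closed subspaces invariant under $\mathcal A$) and whose lattice $\mathcal L=\mathrm{Lat}\,\mathcal A$ of invariant self-adjoint projections is commutative and completely distributive. Let $M(\mathcal L)$ be the set of projections $M\in\mathcal L$, $M\neq I$, that are meet-irreducible (if $M=L_1\wedge L_2$ with $L_1,L_2\in\mathcal L$ then $M=L_1$ or $M=L_2$), with the order of $\mathcal L$ and the topology generated by the sets $[L,I)=\{M\in M(\mathcal L): L\le M\}$, $L\in\mathcal L$, and their complements. A topological edge is a pair $(x,y)$ of points of $M(\mathcal L)$ having neighbourhoods $U_x$, $U_y$ such that $s\le t$ for all $s\in U_x$, $t\in U_y$. For a finite set $F\subseteq M(\mathcal L)$ let $\Delta(F)$ be the simplicial complex whose simplices are the nonempty subsets $s\subseteq F$ such that for any two distinct $x,y\in s$ one of $(x,y)$, $(y,x)$ is a topological edge. The spectral homology of $\mathcal A$ is the direct limit of integral simplicial homology groups $$H_t^{sp}(\mathcal A)=\varinjlim_F H_t(\Delta(F))$$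 over the finite subsets $F$ of $M(\mathcal L)$, with the maps induced by inclusion. Let $d\in\{0,1,2,\dots\}\cup\{\infty\}$ be the linear dimension of the commutant $\mathcal A'$ of $\mathcal A$ (the algebra of bounded operators commuting with every element of $\mathcal A$). Then $$H_0^{sp}(\mathcal A)\cong\mathbb Z^{d},$$ where, for $d=\infty$, $\mathbb Z^{\infty}$ is the restricted direct product (direct sum) of countably many copies of $\mathbb Z$. -/

import Mathlib

open scoped Topology

noncomputable section

/-! ### Integral simplicial homology of abstract simplicial complexes

The vertices are taken from a fixed type `X`. The oriented simplex `[v₀, …, vₙ]` is the product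
`v₀ ∧ ⋯ ∧ vₙ` in the exterior algebra of the free abelian group on `X`, so that it changes by the
sign of the permutation when its vertices are permuted, and the groups of oriented chains are free
on the simplices of the complex. -/

namespace SimplicialHomology

variable {X : Type*}

/-- The ambient ring of all oriented integral chains with vertices in `X`. -/
abbrev Chains (X : Type*) : Type _ := ExteriorAlgebra ℤ (X →₀ ℤ)

/-- The oriented simplex `[v₀, …, vₙ₋₁]`. -/
def oriented {n : ℕ} (v : Fin n → X) : Chains X :=
  ExteriorAlgebra.ιMulti ℤ n fun i => Finsupp.single (v i) (1 : ℤ)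

/-- The map `X →₀ ℤ → ℤ` taking every vertex to `1`. -/
def augmentation (X : Type*) : Module.Dual ℤ (X →₀ ℤ) :=
  Finsupp.lsum ℤ fun _ => LinearMap.id

/-- The boundary operator: contraction with the augmentation. It is given by the usual formula,
see `boundary_oriented`. -/
def boundary (X : Type*) : Chains X →ₗ[ℤ] Chains X :=
  CliffordAlgebra.contractLeft (Q := (0 : QuadraticForm ℤ (X →₀ ℤ))) (augmentation X)

/-- `∂[v₀, …, vₙ] = ∑ i, (-1) ^ i [v₀, …, v̂ᵢ, …, vₙ]`. -/
theorem boundary_oriented {n : ℕ} (v : Fin (n + 1) → X) :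
    boundary X (oriented v) =
      ∑ i : Fin (n + 1), (-1 : ℤ) ^ (i : ℕ) • oriented (i.removeNth v) := by
  have aug : ∀ x : X, augmentation X (Finsupp.single x 1) = 1 := fun x => by
    simp [augmentation]
  have succ : ∀ {m : ℕ} (w : Fin (m + 1) → X), oriented w =
      CliffordAlgebra.ι (0 : QuadraticForm ℤ (X →₀ ℤ)) (Finsupp.single (w 0) 1) *
        oriented (fun i => w i.succ) := fun w => ExteriorAlgebra.ιMulti_succ_apply _
  have step : ∀ {m : ℕ} (w : Fin (m + 1) → X), boundary X (oriented w) =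
      oriented (fun i => w i.succ) -
        CliffordAlgebra.ι (0 : QuadraticForm ℤ (X →₀ ℤ)) (Finsupp.single (w 0) 1) *
          boundary X (oriented fun i => w i.succ) := fun w => by
    rw [succ w]
    exact (CliffordAlgebra.contractLeft_ι_mul _ _ _).trans (by rw [aug, one_smul]; rfl)
  induction n with
  | zero =>
    rw [step]
    have h1 : oriented (fun i : Fin 0 => v i.succ) = 1 := ExteriorAlgebra.ιMulti_zero_apply _
    have h2 : oriented (Fin.removeNth 0 v) = 1 := ExteriorAlgebra.ιMulti_zero_apply _
    have h3 : boundary X 1 = 0 := CliffordAlgebra.contractLeft_one _ _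
    rw [h1, h3, mul_zero, sub_zero, Fin.sum_univ_succ, Fin.sum_univ_zero, h2]
    simp
  | succ n ih =>
    rw [step, ih, Fin.sum_univ_succ (n := n + 1), Finset.mul_sum]
    have h0 : Fin.removeNth 0 v = fun i => v i.succ := by
      funext i; simp [Fin.removeNth]
    rw [h0, sub_eq_add_neg, ← Finset.sum_neg_distrib]
    simp only [Fin.val_zero, pow_zero, one_smul]
    congr 1
    refine Finset.sum_congr rfl fun i _ => ?_
    rw [succ (i.succ.removeNth v)]
    have hz : i.succ.removeNth v 0 = v 0 := by simp [Fin.removeNth]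
    have hs : (fun j : Fin n => i.succ.removeNth v j.succ) =
        i.removeNth (fun j => v j.succ) := by
      funext j; simp [Fin.removeNth]
    rw [hz, hs, mul_smul_comm, Fin.val_succ, pow_succ]
    simp

theorem boundary_boundary (c : Chains X) : boundary X (boundary X c) = 0 :=
  CliffordAlgebra.contractLeft_contractLeft (augmentation X) c

/-- The group of oriented `n`-chains of the complex `K`: it is generated by the oriented simplices
`[v₀, …, vₙ]` whose vertex set is a face of `K`. -/
def chainGroup (K : PreAbstractSimplicialComplex X) (n : ℕ) : Submodule ℤ (Chains X) :=
  Submodule.span ℤ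
    {c | ∃ v : Fin (n + 1) → X, (∃ s ∈ K, (s : Set X) = Set.range v) ∧ c = oriented v}

/-- The `n`-cycles of `K`. Every `0`-chain is a cycle (the homology is not reduced). -/
def cycles (K : PreAbstractSimplicialComplex X) : ℕ → Submodule ℤ (Chains X)
  | 0 => chainGroup K 0
  | n + 1 => chainGroup K (n + 1) ⊓ LinearMap.ker (boundary X)

/-- The `n`-boundaries of `K`. -/
def boundaries (K : PreAbstractSimplicialComplex X) (n : ℕ) : Submodule ℤ (Chains X) :=
  (chainGroup K (n + 1)).map (boundary X)

theorem boundaries_le_cycles (K : PreAbstractSimplicialComplex X) (n : ℕ) :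
    boundaries K n ≤ cycles K n := by
  have key : boundaries K n ≤ chainGroup K n := by
    rw [boundaries, chainGroup, Submodule.map_span, Submodule.span_le]
    rintro _ ⟨_, ⟨v, ⟨s, hs, hv⟩, rfl⟩, rfl⟩
    rw [boundary_oriented]
    refine Submodule.sum_mem _ fun i _ => Submodule.smul_mem _ _ (Submodule.subset_span ?_)
    classical
    refine ⟨i.removeNth v, ⟨Finset.univ.image (i.removeNth v), ?_, by simp⟩, rfl⟩
    refine (K.isRelLowerSet_faces hs).2 ?_ (Finset.univ_nonempty.image _)
    rw [← Finset.coe_subset, hv]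
    simpa using! Set.range_comp_subset_range i.succAbove v
  cases n with
  | zero => exact key
  | succ n =>
    refine le_inf key ?_
    rintro _ ⟨c, -, rfl⟩
    exact boundary_boundary c

/-- The integral simplicial homology group `H_n(K)`: cycles modulo boundaries. -/
abbrev Homology (K : PreAbstractSimplicialComplex X) (n : ℕ) : Type _ :=
  cycles K n ⧸ (boundaries K n).submoduleOf (cycles K n)

theorem chainGroup_mono {K L : PreAbstractSimplicialComplex X} (h : K ≤ L) (n : ℕ) :
    chainGroup K n ≤ chainGroup L n :=
  Submodule.span_mono fun _ ⟨v, ⟨s, hs, hv⟩, hc⟩ => ⟨v, ⟨s, h hs, hv⟩, hc⟩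

theorem cycles_mono {K L : PreAbstractSimplicialComplex X} (h : K ≤ L) :
    ∀ n, cycles K n ≤ cycles L n
  | 0 => chainGroup_mono h 0
  | n + 1 => inf_le_inf_right _ (chainGroup_mono h (n + 1))

/-- The homomorphism `H_n(K) → H_n(L)` induced by an inclusion `K ⊆ L`. -/
def homologyMap {K L : PreAbstractSimplicialComplex X} (h : K ≤ L) (n : ℕ) :
    Homology K n →ₗ[ℤ] Homology L n :=
  Submodule.mapQ _ _ (Submodule.inclusion (cycles_mono h n)) fun _ hx =>
    Submodule.map_mono (chainGroup_mono h (n + 1)) hx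

end SimplicialHomology

/-! ### Point-neighbourhood homology of a partially ordered topological space -/

namespace PointNeighbourhood

variable {X : Type*} [PartialOrder X] [TopologicalSpace X]

/-- `(x, y)` is a topological edge: some neighbourhood of `x` lies below some neighbourhood
of `y`. -/
def IsEdge (x y : X) : Prop :=
  ∃ U ∈ 𝓝 x, ∃ V ∈ 𝓝 y, ∀ s ∈ U, ∀ t ∈ V, s ≤ t

variable (X) in
/-- The undirected graph (without loops) underlying the digraph of topological edges. -/
def edgeGraph : SimpleGraph X := SimpleGraph.fromRel IsEdge

/-- The complex `Δ(F)`: its simplices are the vertex sets of the (nonempty) complete subgraphs of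
the undirected graph of topological edges between points of the finite set `F`. -/
def complex (F : Finset X) : PreAbstractSimplicialComplex X where
  faces := {s | s.Nonempty ∧ s ⊆ F ∧ (edgeGraph X).IsClique (s : Set X)}
  isRelLowerSet_faces := fun _ ⟨hne, hF, hc⟩ =>
    ⟨hne, fun _ hts ht => ⟨ht, hts.trans hF, Set.Pairwise.mono (Finset.coe_subset.mpr hts) hc⟩⟩

theorem complex_mono {F G : Finset X} (h : F ≤ G) : complex F ≤ complex G :=
  fun _ hs => ⟨hs.1, hs.2.1.trans h, hs.2.2⟩

variable (X) in
open Classical in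
/-- The point-neighbourhood homology group `H_n(X)`: the direct limit of the groups `H_n(Δ(F))`
over the finite subsets `F` of `X`. -/
abbrev Homology (n : ℕ) : Type _ :=
  Module.DirectLimit (fun F : Finset X => SimplicialHomology.Homology (complex F) n)
    fun _ _ h => SimplicialHomology.homologyMap (complex_mono h) n

end PointNeighbourhood

/-! ### Operator algebras and their invariant projection lattices -/

namespace OperatorAlgebra

universe u

variable {H : Type*} [NormedAddCommGroup H] [InnerProductSpace ℂ H]

/-- The lattice of closed subspaces of `H` that are invariant under `A`. A self-adjoint projection
is identified with its range, so that the order `P ≤ Q ↔ P Q = P` of projections is the inclusion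
of ranges. -/
def lat (A : Subalgebra ℂ (H →L[ℂ] H)) : CompleteSublattice (ClosedSubmodule ℂ H) :=
  CompleteSublattice.mk' {K | ∀ T ∈ A, ∀ x ∈ K, T x ∈ K}
    (by
      intro S hS T hT x hx
      have hle : sSup S ≤ (sSup S).comap T := sSup_le fun K hK y hy =>
        (le_sSup hK : K ≤ sSup S) (hS hK T hT y hy)
      exact hle hx)
    (by
      intro S hS T hT x hx
      rw [ClosedSubmodule.mem_sInf] at hx ⊢
      exact fun K hK => hS hK T hT x (hx K hK))

/-- `A` is reflexive: it contains every operator that leaves invariant all the closed subspaces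
that `A` leaves invariant. -/
def IsReflexive (A : Subalgebra ℂ (H →L[ℂ] H)) : Prop :=
  ∀ T : H →L[ℂ] H, (∀ K ∈ lat A, ∀ x ∈ K, T x ∈ K) → T ∈ A

/-- Complete distributivity of a complete lattice: arbitrary meets distribute over arbitrary joins
(this form is self-dual). -/
def IsCompletelyDistributive (L : Type u) [CompleteLattice L] : Prop :=
  ∀ (ι : Type u) (κ : ι → Type u) (f : ∀ a, κ a → L),
    (⨅ a, ⨆ b, f a b) = ⨆ g : ∀ a, κ a, ⨅ a, f a (g a)

/-- A CDCSL algebra: a reflexive operator algebra whose invariant projections commute with each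
other and form a completely distributive lattice. -/
structure IsCDCSL [CompleteSpace H] (A : Subalgebra ℂ (H →L[ℂ] H)) : Prop where
  reflexive : IsReflexive A
  commute : ∀ K ∈ lat A, ∀ L ∈ lat A,
    Commute K.toSubmodule.starProjection L.toSubmodule.starProjection
  completelyDistributive : IsCompletelyDistributive (lat A)

/-- The set `M(L)` of meet-irreducible elements of `L = Lat A`, excluding the identity (an
`InfIrred` element is by definition not the top element), with the order of `L`. -/
def MeetIrr (A : Subalgebra ℂ (H →L[ℂ] H)) : Type _ := {M : lat A // InfIrred M}

instance (A : Subalgebra ℂ (H →L[ℂ] H)) : PartialOrder (MeetIrr A) :=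
  Subtype.partialOrder _

/-- The semi-interval `[L, I)` in `M(Lat A)`. -/
def semiInterval (A : Subalgebra ℂ (H →L[ℂ] H)) (L : lat A) : Set (MeetIrr A) :=
  {M | L ≤ M.1}

/-- The topology of `M(Lat A)` generated by the semi-intervals `[L, I)` and their complements,
where `L` ranges over all of `Lat A`. -/
instance (A : Subalgebra ℂ (H →L[ℂ] H)) : TopologicalSpace (MeetIrr A) :=
  TopologicalSpace.generateFrom
    (Set.range (semiInterval A) ∪ Set.range fun L => (semiInterval A L)ᶜ)

/-- The spectral homology group `H_n^{sp}(A)`. -/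
abbrev SpectralHomology (A : Subalgebra ℂ (H →L[ℂ] H)) (n : ℕ) : Type _ :=
  PointNeighbourhood.Homology (MeetIrr A) n

/-- The commutant of `A`, the algebra of all bounded operators commuting with every element
of `A`. -/
abbrev commutant (A : Subalgebra ℂ (H →L[ℂ] H)) : Subalgebra ℂ (H →L[ℂ] H) :=
  Subalgebra.centralizer ℂ (A : Set (H →L[ℂ] H))

end OperatorAlgebra

end

/-! Both sides count the connected components of the graph of topological edges. `Homology X 0` is
free on these components for any such `X` (`homologyZeroEquiv`), so it remains to compare their
number with the dimension of the commutant.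

The link is the family of `N` in `Lat A` with `N₋ ≠ I`. Complete distributivity makes these `N` span
`H`, and shows that every meet-irreducible point fails to contain one of them. For such an `N`, all
points not containing `N` lie in one component (`reachable`), and reflexivity puts the rank-one
operators with range in `N` and kernel containing `N₋` into `A`, which forces the commutant to act
on `N` by a scalar. Primeness makes the scalar depend only on the component
(`exists_component_scalar`).

Conversely, commuting projections make the subspaces `N` of different components orthogonal
(`inner_eq_zero`), so the component projections lie in the commutant and are independent. They form
a basis when there are finitely many; otherwise the dimension is infinite, and separability makes
the components countable. -/

noncomputable section
-- Prime elements of completely distributive lattices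
section CompletelyDistributive

variable {L : Type*} [CompletelyDistribLattice L]

theorem exists_sSup_not_le_of_not_le {a b : L} (h : ¬ b ≤ a) :
    ∃ n : L, ¬ n ≤ a ∧ ¬ b ≤ sSup {m | ¬ n ≤ m} := by
  by_contra! hcon
  apply h
  have key : b ≤ ⨅ S : {S : Set L // b ≤ sSup S}, ⨆ s : S.1, (s : L) :=
    le_iInf fun S => S.2.trans (by rw [sSup_eq_iSup'])
  rw [iInf_iSup_eq] at key
  refine key.trans (iSup_le fun g => ?_)
  by_contra hg
  -- With `n` the meet of all values of `g`, the set `{m | ¬ n ≤ m}` is itself one of the covers of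
  -- `b`; the member `g` picks from it lies above `n`, a contradiction.
  exact (g ⟨_, hcon _ hg⟩).2 (iInf_le (fun S => ((g S : S.1) : L)) ⟨_, hcon _ hg⟩)

/-- Iterating the previous lemma from `b` gives a decreasing sequence whose upward closure is a
filter avoiding `a`. Each cover of a term has a member above the next term, so the complement of the
filter has a largest element, which is prime. -/
theorem exists_infPrime_of_not_le {a b : L} (h : ¬ b ≤ a) :
    ∃ x : L, InfPrime x ∧ a ≤ x ∧ ¬ b ≤ x := by
  choose! f hfa hfb using fun b : L => exists_sSup_not_le_of_not_le (a := a) (b := b)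
  let s : ℕ → L := fun n => f^[n] b
  have hs : ∀ n, s (n + 1) = f (s n) := fun n => Function.iterate_succ_apply' f n b
  have hsa : ∀ n, ¬ s n ≤ a := fun n => by
    induction n with
    | zero => exact h
    | succ n ih => rw [hs]; exact hfa _ ih
  have hway : ∀ n (S : Set L), s n ≤ sSup S → ∃ u ∈ S, s (n + 1) ≤ u := fun n S hS => by
    by_contra! hcon
    exact hfb (s n) (hsa n) (hS.trans (sSup_le_sSup fun u hu => by rw [← hs]; exact hcon u hu))
  have hanti : Antitone s := antitone_nat_of_succ_le fun n => by
    obtain ⟨u, hu, hle⟩ := hway n {s n} (by simp)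
    rwa [Set.mem_singleton_iff.mp hu] at hle
  let x := sSup {u | ∀ n, ¬ s n ≤ u}
  have hx : ∀ n, ¬ s n ≤ x := fun n hn => by
    obtain ⟨u, hu, hle⟩ := hway n _ hn
    exact hu _ hle
  have hout : ∀ u, ¬ u ≤ x → ∃ n, s n ≤ u := fun u hu => by
    by_contra! hcon
    exact hu (le_sSup hcon)
  refine ⟨x, ⟨fun hmax => hx 0 ?_, fun {u v} huv => ?_⟩, le_sSup hsa, hx 0⟩
  · rw [isMax_iff_eq_top.mp hmax]; exact le_top
  · by_contra! hcon
    obtain ⟨n, hn⟩ := hout u hcon.1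
    obtain ⟨m, hm⟩ := hout v hcon.2
    exact hx (max n m) ((le_inf ((hanti (le_max_left n m)).trans hn)
      ((hanti (le_max_right n m)).trans hm)).trans huv)

end CompletelyDistributive
end

noncomputable section
-- Homology in degree zero and connected components
namespace SimplicialHomology

variable {X : Type*}

theorem oriented_one (v : Fin 1 → X) :
    oriented v = ExteriorAlgebra.ι ℤ (Finsupp.single (v 0) (1 : ℤ)) := by
  simp [oriented, ExteriorAlgebra.ιMulti_apply]

theorem boundary_oriented_two (v : Fin 2 → X) :
    boundary X (oriented v) = ExteriorAlgebra.ι ℤ (Finsupp.single (v 1) (1 : ℤ)) -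
      ExteriorAlgebra.ι ℤ (Finsupp.single (v 0) (1 : ℤ)) := by
  rw [boundary_oriented, Fin.sum_univ_two, oriented_one, oriented_one]
  simp [Fin.removeNth, sub_eq_add_neg]

end SimplicialHomology

namespace PointNeighbourhood
open SimplicialHomology

variable {X : Type*} [PartialOrder X] [TopologicalSpace X]

variable (X) in
/-- The map on ambient chains that sends a vertex to its component. -/
def componentChain : Chains X →ₗ[ℤ] ((edgeGraph X).ConnectedComponent →₀ ℤ) :=
  Finsupp.lmapDomain ℤ ℤ (edgeGraph X).connectedComponentMk ∘ₗ ExteriorAlgebra.ιInv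

theorem componentChain_single (x : X) :
    componentChain X (ExteriorAlgebra.ι ℤ (Finsupp.single x 1)) =
      Finsupp.single ((edgeGraph X).connectedComponentMk x) 1 := by
  simp [componentChain, ExteriorAlgebra.ι_leftInverse _]

theorem boundaries_le_ker_componentChain (F : Finset X) :
    boundaries (complex F) 0 ≤ LinearMap.ker (componentChain X) := by
  rw [boundaries, chainGroup, Submodule.map_span, Submodule.span_le]
  rintro _ ⟨_, ⟨v, ⟨s, hs, hv⟩, rfl⟩, rfl⟩
  have h0 : v 0 ∈ (s : Set X) := hv ▸ Set.mem_range_self 0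
  have h1 : v 1 ∈ (s : Set X) := hv ▸ Set.mem_range_self 1
  have hc : (edgeGraph X).connectedComponentMk (v 1) =
      (edgeGraph X).connectedComponentMk (v 0) := by
    by_cases h : v 1 = v 0
    · rw [h]
    · exact SimpleGraph.ConnectedComponent.sound (hs.2.2 h1 h0 h).reachable
  rw [SetLike.mem_coe, LinearMap.mem_ker, boundary_oriented_two, map_sub, componentChain_single,
    componentChain_single, hc, sub_self]

/-- The map `H₀(Δ(F)) → ℤ[π₀]` sending the class of a vertex to its component. -/
def homologyZeroToComponents (F : Finset X) :
    SimplicialHomology.Homology (complex F) 0 →ₗ[ℤ] ((edgeGraph X).ConnectedComponent →₀ ℤ) :=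
  Submodule.liftQ _ (componentChain X ∘ₗ (cycles (complex F) 0).subtype) fun _ hc =>
    boundaries_le_ker_componentChain F hc

theorem vertex_mem_cycles {F : Finset X} {x : X} (hx : x ∈ F) :
    ExteriorAlgebra.ι ℤ (Finsupp.single x (1 : ℤ)) ∈ cycles (complex F) 0 := by
  refine Submodule.subset_span ⟨fun _ => x, ⟨{x}, ⟨?_, ?_, ?_⟩, ?_⟩, ?_⟩
  · simp
  · simpa using hx
  · simp
  · simp
  · rw [oriented_one]

/-- The class of a vertex in `H₀(Δ(F))`. -/
def vertexClass {F : Finset X} {x : X} (hx : x ∈ F) :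
    SimplicialHomology.Homology (complex F) 0 :=
  Submodule.Quotient.mk ⟨_, vertex_mem_cycles hx⟩

theorem homologyZeroToComponents_vertexClass {F : Finset X} {x : X} (hx : x ∈ F) :
    homologyZeroToComponents F (vertexClass hx) =
      Finsupp.single ((edgeGraph X).connectedComponentMk x) 1 :=
  componentChain_single x

theorem vertexClass_eq_of_adj {F : Finset X} {x y : X} (hx : x ∈ F) (hy : y ∈ F)
    (h : (edgeGraph X).Adj x y) : vertexClass hx = vertexClass hy := by
  classical
  refine (Submodule.Quotient.eq _).mpr ?_
  -- The order `y, x` makes the boundary `x - y`.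
  refine ⟨oriented ![y, x], Submodule.subset_span ⟨_, ⟨{x, y}, ⟨?_, ?_, ?_⟩, ?_⟩, rfl⟩, ?_⟩
  · simp
  · simp [Finset.insert_subset_iff, hx, hy]
  · simpa [SimpleGraph.isClique_pair] using fun _ => h
  · simp [Set.pair_comm]
  · rw [boundary_oriented_two]
    rfl

theorem span_vertexClass (F : Finset X) :
    Submodule.span ℤ {c | ∃ x, ∃ hx : x ∈ F, c = vertexClass hx} = ⊤ := by
  rw [eq_top_iff]
  rintro c -
  obtain ⟨⟨c, hc⟩, rfl⟩ := Submodule.Quotient.mk_surjective _ c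
  induction hc using Submodule.span_induction with
  | mem c hc =>
    obtain ⟨v, ⟨s, hs, hv⟩, rfl⟩ := hc
    have h0 : v 0 ∈ F := hs.2.1 (by rw [← Finset.mem_coe, hv]; exact Set.mem_range_self 0)
    refine Submodule.subset_span ⟨v 0, h0, ?_⟩
    simp only [vertexClass, oriented_one]
  | zero => exact Submodule.zero_mem _
  | add a b ha hb iha ihb => exact Submodule.add_mem _ iha ihb
  | smul r a ha iha => exact Submodule.smul_mem _ r iha

open Classical in
variable (X) in
/-- The map `H₀(X) → ℤ[π₀]`. -/
def homologyToComponents : Homology X 0 →ₗ[ℤ] ((edgeGraph X).ConnectedComponent →₀ ℤ) :=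
  Module.DirectLimit.lift ℤ (Finset X) _ _ homologyZeroToComponents fun F G h c => by
    obtain ⟨c, rfl⟩ := Submodule.Quotient.mk_surjective _ c
    rfl

open Classical in
/-- The class of a point in `H₀(X)`. -/
def pointClass (x : X) : Homology X 0 :=
  Module.DirectLimit.of ℤ (Finset X) (fun F : Finset X => SimplicialHomology.Homology (complex F) 0)
    (fun _ _ h => homologyMap (complex_mono h) 0) {x} (vertexClass (Finset.mem_singleton_self x))

open Classical in
theorem of_vertexClass {F : Finset X} {x : X} (hx : x ∈ F) :
    Module.DirectLimit.of ℤ (Finset X)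
      (fun F : Finset X => SimplicialHomology.Homology (complex F) 0)
      (fun _ _ h => homologyMap (complex_mono h) 0) F (vertexClass hx) = pointClass x := by
  have h : ({x} : Finset X) ≤ F := Finset.singleton_subset_iff.mpr hx
  rw [pointClass, ← Module.DirectLimit.of_f (hij := h)]
  rfl

theorem pointClass_eq_of_adj {x y : X} (h : (edgeGraph X).Adj x y) :
    pointClass x = pointClass y := by
  classical
  have hx : x ∈ ({x, y} : Finset X) := by simp
  have hy : y ∈ ({x, y} : Finset X) := by simp
  rw [← of_vertexClass hx, ← of_vertexClass hy, vertexClass_eq_of_adj hx hy h]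

theorem pointClass_eq_of_reachable {x y : X} (h : (edgeGraph X).Reachable x y) :
    pointClass x = pointClass y := by
  obtain ⟨p⟩ := h
  induction p with
  | nil => rfl
  | cons hadj _ ih => exact (pointClass_eq_of_adj hadj).trans ih

variable (X) in
/-- The map `ℤ[π₀] → H₀(X)` sending a component to the class of any of its points. -/
def componentsToHomology : ((edgeGraph X).ConnectedComponent →₀ ℤ) →ₗ[ℤ] Homology X 0 :=
  Finsupp.linearCombination ℤ
    (SimpleGraph.ConnectedComponent.lift pointClass fun _ _ p _ =>
      pointClass_eq_of_reachable p.reachable)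

theorem homologyToComponents_pointClass (x : X) :
    homologyToComponents X (pointClass x) =
      Finsupp.single ((edgeGraph X).connectedComponentMk x) 1 := by
  classical
  rw [homologyToComponents, pointClass]
  erw [Module.DirectLimit.lift_of]
  exact homologyZeroToComponents_vertexClass _

theorem componentsToHomology_single (x : X) :
    componentsToHomology X (Finsupp.single ((edgeGraph X).connectedComponentMk x) 1) =
      pointClass x := by
  simp [componentsToHomology]

variable (X) in
/-- The zeroth point-neighbourhood homology is free on the components of the edge graph. -/
def homologyZeroEquiv : Homology X 0 ≃ₗ[ℤ] ((edgeGraph X).ConnectedComponent →₀ ℤ) :=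
  LinearEquiv.ofLinearMap (homologyToComponents X) (componentsToHomology X)
    (by
      refine Finsupp.lhom_ext' fun c => LinearMap.ext_ring ?_
      induction c using SimpleGraph.ConnectedComponent.ind with
      | h x =>
        simp only [LinearMap.comp_apply, Finsupp.lsingle_apply, LinearMap.id_apply]
        rw [componentsToHomology_single, homologyToComponents_pointClass])
    (by
      classical
      refine Module.DirectLimit.hom_ext fun F => ?_
      refine LinearMap.ext_on (span_vertexClass F) ?_
      rintro _ ⟨x, hx, rfl⟩
      simp only [LinearMap.comp_apply, LinearMap.id_apply]
      rw [of_vertexClass, homologyToComponents_pointClass, componentsToHomology_single])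

end PointNeighbourhood
end

noncomputable section
-- Edges and components in the spectrum of `Lat A`
namespace OperatorAlgebra

variable {H : Type*} [NormedAddCommGroup H] [InnerProductSpace ℂ H]
variable {A : Subalgebra ℂ (H →L[ℂ] H)}

/-- The join `N₋` of all the elements of `Lat A` that do not contain `N`. -/
def lowerJoin (N : lat A) : lat A := sSup {M | ¬ N ≤ M}

variable (A) in
/-- The graph of topological edges between meet-irreducible elements of `Lat A`. -/
abbrev latGraph : SimpleGraph (MeetIrr A) := PointNeighbourhood.edgeGraph (MeetIrr A)

theorem le_of_isEdge {x y : MeetIrr A} (h : PointNeighbourhood.IsEdge x y) : x ≤ y := by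
  obtain ⟨U, hU, V, hV, h⟩ := h
  exact h x (mem_of_mem_nhds hU) y (mem_of_mem_nhds hV)

/-- The element `N₋` separates the two basic open sets: points not containing `N` lie below it, by
definition of the join. -/
theorem isEdge_of_lowerJoin_le {x z : MeetIrr A} {N : lat A} (hx : ¬ N ≤ x.1)
    (hz : lowerJoin N ≤ z.1) : PointNeighbourhood.IsEdge x z := by
  refine ⟨(semiInterval A N)ᶜ, ?_, semiInterval A (lowerJoin N), ?_, fun s hs t ht => ?_⟩
  · exact (TopologicalSpace.isOpen_generateFrom_of_mem (Or.inr ⟨N, rfl⟩)).mem_nhds hx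
  · exact (TopologicalSpace.isOpen_generateFrom_of_mem (Or.inl ⟨_, rfl⟩)).mem_nhds hz
  · exact (le_sSup (show s.1 ∈ {M | ¬ N ≤ M} from hs)).trans ht

theorem reachable_of_isEdge {x y : MeetIrr A} (h : PointNeighbourhood.IsEdge x y) :
    (latGraph A).Reachable x y := by
  by_cases hxy : x = y
  · rw [hxy]
  · exact SimpleGraph.Adj.reachable ((SimpleGraph.fromRel_adj _ _ _).mpr ⟨hxy, Or.inl h⟩)

/-- Joins in `Lat A` are joins of closed subspaces. -/
theorem coe_sSup_le {S : Set (lat A)} {K : ClosedSubmodule ℂ H}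
    (h : ∀ N ∈ S, (N : ClosedSubmodule ℂ H) ≤ K) : ((sSup S : lat A) : ClosedSubmodule ℂ H) ≤ K := by
  rw [CompleteSublattice.coe_sSup]
  refine sSup_le ?_
  rintro _ ⟨N, hN, rfl⟩
  exact h N hN

variable [CompleteSpace H]

namespace IsCDCSL

variable (hA : IsCDCSL A)
include hA

/-- The invariant subspace lattice of a CDCSL algebra, as a completely distributive lattice. -/
abbrev completelyDistribLattice : CompletelyDistribLattice (lat A) :=
  CompletelyDistribLattice.ofMinimalAxioms ⟨fun f => hA.completelyDistributive _ _ f⟩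

theorem exists_lowerJoin_of_not_le {a b : lat A} (h : ¬ b ≤ a) :
    ∃ N : lat A, ¬ N ≤ a ∧ ¬ b ≤ lowerJoin N :=
  letI := hA.completelyDistribLattice
  exists_sSup_not_le_of_not_le h

theorem infPrime (x : MeetIrr A) : InfPrime x.1 :=
  letI := hA.completelyDistribLattice
  x.2.infPrime

theorem exists_meetIrr_of_not_le {a b : lat A} (h : ¬ b ≤ a) :
    ∃ x : MeetIrr A, a ≤ x.1 ∧ ¬ b ≤ x.1 :=
  letI := hA.completelyDistribLattice
  let ⟨x, hx, hax, hbx⟩ := exists_infPrime_of_not_le h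
  ⟨⟨x, hx.infIrred⟩, hax, hbx⟩

theorem inf_not_le {x : MeetIrr A} {N M : lat A} (hN : ¬ N ≤ x.1) (hM : ¬ M ≤ x.1) :
    ¬ N ⊓ M ≤ x.1 := fun h => ((hA.infPrime x).2 h).elim hN hM

theorem exists_lowerJoin_ne_top (x : MeetIrr A) :
    ∃ N : lat A, ¬ N ≤ x.1 ∧ lowerJoin N ≠ ⊤ := by
  obtain ⟨N, hN, h⟩ := hA.exists_lowerJoin_of_not_le (a := x.1) (b := ⊤)
    fun h => (hA.infPrime x).1 (isMax_iff_eq_top.mpr (top_le_iff.mp h))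
  exact ⟨N, hN, fun h' => h (by rw [h'])⟩

/-- Any point `z ≥ N₋` is a common upper neighbour of `x` and `y`. -/
theorem reachable {N : lat A} (hN : lowerJoin N ≠ ⊤) {x y : MeetIrr A} (hx : ¬ N ≤ x.1)
    (hy : ¬ N ≤ y.1) : (latGraph A).Reachable x y := by
  obtain ⟨z, hz, -⟩ := hA.exists_meetIrr_of_not_le fun h : ⊤ ≤ lowerJoin N => hN (top_le_iff.mp h)
  exact (reachable_of_isEdge (isEdge_of_lowerJoin_le hx hz)).trans
    (reachable_of_isEdge (isEdge_of_lowerJoin_le hy hz)).symm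

theorem exists_not_le_of_mem {N : lat A} {v : H} (hv : v ∈ N.1) (h0 : v ≠ 0) :
    ∃ x : MeetIrr A, ¬ N ≤ x.1 := by
  obtain ⟨x, -, hx⟩ := hA.exists_meetIrr_of_not_le (a := ⊥) (b := N)
    fun h => h0 (ClosedSubmodule.mem_bot.mp (h hv))
  exact ⟨x, hx⟩

omit hA [CompleteSpace H] in
theorem exists_ne_zero_mem {N : lat A} {x : MeetIrr A} (hx : ¬ N ≤ x.1) : ∃ v ∈ N.1, v ≠ 0 := by
  by_contra! h
  exact hx fun v hv => by rw [h v hv]; exact zero_mem _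

/-- A closed subspace containing all `N` with `N₋ ≠ I` is the whole space. -/
theorem eq_top_of_forall_le {K : ClosedSubmodule ℂ H}
    (h : ∀ N : lat A, lowerJoin N ≠ ⊤ → N.1 ≤ K) : K = ⊤ := by
  have htop : sSup {N : lat A | lowerJoin N ≠ ⊤} = ⊤ := by
    by_contra hne
    obtain ⟨N, hN, hlow⟩ := hA.exists_lowerJoin_of_not_le fun h => hne (top_le_iff.mp h)
    exact hN (le_sSup fun h' => hlow (by rw [h']))
  have := coe_sSup_le (S := {N : lat A | lowerJoin N ≠ ⊤}) (K := K) fun N hN => h N hN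
  rw [htop] at this
  exact top_le_iff.mp this

theorem operator_ext {S T : H →L[ℂ] H}
    (h : ∀ N : lat A, lowerJoin N ≠ ⊤ → ∀ v ∈ N.1, S v = T v) : S = T := by
  let K : ClosedSubmodule ℂ H := (⊥ : ClosedSubmodule ℂ H).comap (S - T)
  have hK : K = ⊤ := hA.eq_top_of_forall_le fun N hN v hv => by
    simpa [K, sub_eq_zero] using h N hN v hv
  ext v
  have hv : v ∈ K := hK ▸ ClosedSubmodule.mem_top
  simpa [K, sub_eq_zero] using hv

/-! ### The commutant acts by one scalar per component -/

theorem rankOne_mem {N : lat A} {x y : H} (hx : x ∈ N.1)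
    (hy : ∀ v ∈ (lowerJoin N).1, inner ℂ y v = 0) : InnerProductSpace.rankOne ℂ x y ∈ A := by
  refine hA.reflexive _ fun K hK v hv => ?_
  rw [InnerProductSpace.rankOne_apply]
  by_cases hNK : N ≤ ⟨K, hK⟩
  · exact SMulMemClass.smul_mem _ (hNK hx)
  · rw [hy v (le_sSup (show (⟨K, hK⟩ : lat A) ∈ {M | ¬ N ≤ M} from hNK) hv), zero_smul]
    exact zero_mem _

theorem exists_scalar {N : lat A} (hN : lowerJoin N ≠ ⊤) {T : H →L[ℂ] H}
    (hT : T ∈ commutant A) : ∃ l : ℂ, ∀ v ∈ N.1, T v = l • v := by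
  obtain ⟨y, hy, hy0⟩ : ∃ y ∈ (lowerJoin N).1.toSubmoduleᗮ, y ≠ 0 := by
    refine Submodule.exists_mem_ne_zero_of_ne_bot fun h => hN ?_
    rw [Submodule.orthogonal_eq_bot_iff] at h
    exact Subtype.ext (ClosedSubmodule.toSubmodule_injective h)
  -- Commuting `T` with the rank-one operator `v ⊗ y*` and evaluating at `y` gives `⟨y, y⟩ T v = ⟨y,
  -- T y⟩ v`.
  refine ⟨inner ℂ y (T y) / inner ℂ y y, fun v hv => ?_⟩
  have hmem := hA.rankOne_mem hv fun w hw => Submodule.inner_left_of_mem_orthogonal hw hy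
  have h := DFunLike.congr_fun (Subalgebra.mem_centralizer_iff ℂ |>.mp hT _ hmem) y
  simp only [mul_apply_eq_comp, InnerProductSpace.rankOne_apply, map_smul] at h
  rw [div_eq_inv_mul, mul_smul, h, smul_smul, inv_mul_cancel₀ (inner_self_ne_zero.mpr hy0),
    one_smul]

theorem exists_component_scalar {T : H →L[ℂ] H} (hT : T ∈ commutant A) :
    ∃ f : (latGraph A).ConnectedComponent → ℂ, ∀ (N : lat A) (x : MeetIrr A),
      lowerJoin N ≠ ⊤ → ¬ N ≤ x.1 → ∀ v ∈ N.1, T v = f ((latGraph A).connectedComponentMk x) • v := by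
  choose N hNx hN using hA.exists_lowerJoin_ne_top
  choose g hg using fun x => hA.exists_scalar (hN x) hT
  have key : ∀ (M : lat A) (x : MeetIrr A), lowerJoin M ≠ ⊤ → ¬ M ≤ x.1 → ∀ v ∈ M.1,
      T v = g x • v := fun M x hM hMx v hv => by
    obtain ⟨l, hl⟩ := hA.exists_scalar hM hT
    -- Since `x` is prime, `N x ⊓ M` is nonzero, and a common nonzero vector identifies the two
    -- scalars.
    obtain ⟨w, hw, hw0⟩ := exists_ne_zero_mem (hA.inf_not_le (hNx x) hMx)
    rw [hl v hv, smul_left_injective ℂ hw0 ((hg x w hw.1).symm.trans (hl w hw.2))]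
  have hle : ∀ x y, PointNeighbourhood.IsEdge x y → g x = g y := fun x y hxy => by
    obtain ⟨w, hw, hw0⟩ := exists_ne_zero_mem (hNx y)
    exact smul_left_injective ℂ hw0 ((key (N y) x (hN y) (fun h => hNx y (h.trans (le_of_isEdge hxy)))
      w hw).symm.trans (hg y w hw))
  have hadj : ∀ x y, (latGraph A).Adj x y → g x = g y := fun x y hxy =>
    ((SimpleGraph.fromRel_adj _ _ _).mp hxy).2.elim (hle x y) fun h => (hle y x h).symm
  refine ⟨SimpleGraph.ConnectedComponent.lift g fun x y p _ => ?_, fun M x => key M x⟩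
  induction p with
  | nil => rfl
  | cons h _ ih => exact (hadj _ _ h).trans (ih (SimpleGraph.Walk.IsPath.of_cons ‹_›))

/-! ### Orthogonality of components and the dimension of the commutant -/

theorem inner_eq_zero {N M : lat A} (hN : lowerJoin N ≠ ⊤) (hM : lowerJoin M ≠ ⊤)
    {x y : MeetIrr A} (hx : ¬ N ≤ x.1) (hy : ¬ M ≤ y.1) (hxy : ¬ (latGraph A).Reachable x y)
    {v w : H} (hv : v ∈ N.1) (hw : w ∈ M.1) : inner ℂ v w = 0 := by
  let P := N.1.toSubmodule.starProjection
  let Q := M.1.toSubmodule.starProjection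
  have hPQ : P (Q v) = Q (P v) := DFunLike.congr_fun (hA.commute N.1 N.2 M.1 M.2).eq v
  have hPv : P v = v := Submodule.starProjection_eq_self_iff.mpr hv
  have hQw : Q w = w := Submodule.starProjection_eq_self_iff.mpr hw
  rw [hPv] at hPQ
  have hmem : Q v ∈ (N ⊓ M).1 :=
    ⟨Submodule.starProjection_eq_self_iff.mp hPQ, Submodule.starProjection_apply_mem _ v⟩
  -- A nonzero vector of `N ⊓ M` yields a point `z` containing neither `N` nor `M`, which would
  -- connect `x` to `y`.
  have hQv : Q v = 0 := by
    by_contra h0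
    obtain ⟨z, hz⟩ := hA.exists_not_le_of_mem hmem h0
    exact hxy ((hA.reachable hN hx fun h => hz (inf_le_left.trans h)).trans
      (hA.reachable hM (fun h => hz (inf_le_right.trans h)) hy))
  rw [← hQw, ← Submodule.inner_starProjection_left_eq_right]
  exact (congrArg (fun u => inner ℂ u w) hQv).trans (inner_zero_left w)

omit hA

/-- The join of all `N` with `N₋ ≠ I` that do not lie below some point of the component `c`. -/
def componentSpace (c : (latGraph A).ConnectedComponent) : lat A :=
  sSup {N | lowerJoin N ≠ ⊤ ∧ ∃ x, (latGraph A).connectedComponentMk x = c ∧ ¬ N ≤ x.1}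

/-- The projection onto the subspace of a component. -/
def componentProj (c : (latGraph A).ConnectedComponent) : H →L[ℂ] H :=
  (componentSpace c).1.toSubmodule.starProjection

theorem componentProj_apply_self {N : lat A} (hN : lowerJoin N ≠ ⊤) {x : MeetIrr A}
    (hx : ¬ N ≤ x.1) {v : H} (hv : v ∈ N.1) :
    componentProj ((latGraph A).connectedComponentMk x) v = v :=
  Submodule.starProjection_eq_self_iff.mpr
    ((le_sSup (show N ∈ {N | lowerJoin N ≠ ⊤ ∧ _} from ⟨hN, x, rfl, hx⟩) : N ≤ componentSpace _) hv)

include hA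

theorem componentProj_apply_of_ne {N : lat A} (hN : lowerJoin N ≠ ⊤) {x : MeetIrr A}
    (hx : ¬ N ≤ x.1) {c : (latGraph A).ConnectedComponent}
    (hc : (latGraph A).connectedComponentMk x ≠ c) {v : H} (hv : v ∈ N.1) :
    componentProj c v = 0 := by
  have hle : (componentSpace c).1 ≤ N.1ᗮ := coe_sSup_le fun M hM w hw => by
    obtain ⟨hM, y, rfl, hy⟩ := hM
    refine (Submodule.mem_orthogonal _ _).mpr fun u hu => ?_
    exact hA.inner_eq_zero hN hM hx hy (fun h => hc (SimpleGraph.ConnectedComponent.sound h)) hu hw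
  exact (Submodule.starProjection_apply_eq_zero_iff _).mpr
    ((Submodule.mem_orthogonal' _ _).mpr fun w hw =>
      Submodule.inner_right_of_mem_orthogonal hv (hle hw))

/-- Each `N` with `N₋ ≠ I` is invariant under `A`, and the projection acts on it as `0` or `1`. -/
theorem componentProj_mem_commutant (c : (latGraph A).ConnectedComponent) :
    componentProj c ∈ commutant A := by
  refine (Subalgebra.mem_centralizer_iff ℂ).mpr fun T hT => hA.operator_ext fun N hN v hv => ?_
  have hTv : T v ∈ N.1 := N.2 T hT v hv
  by_cases h0 : v = 0
  · simp [h0]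
  obtain ⟨x, hx⟩ := hA.exists_not_le_of_mem hv h0
  simp only [mul_apply_eq_comp]
  by_cases hc : (latGraph A).connectedComponentMk x = c
  · subst hc
    rw [componentProj_apply_self hN hx hv, componentProj_apply_self hN hx hTv]
  · rw [hA.componentProj_apply_of_ne hN hx hc hv, hA.componentProj_apply_of_ne hN hx hc hTv,
      map_zero]

theorem sum_smul_componentProj_apply {N : lat A} (hN : lowerJoin N ≠ ⊤) {x : MeetIrr A}
    (hx : ¬ N ≤ x.1) {v : H} (hv : v ∈ N.1) (s : Finset (latGraph A).ConnectedComponent)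
    (hs : (latGraph A).connectedComponentMk x ∈ s) (f : (latGraph A).ConnectedComponent → ℂ) :
    (∑ c ∈ s, f c • componentProj c) v = f ((latGraph A).connectedComponentMk x) • v := by
  rw [sum_apply, Finset.sum_eq_single_of_mem _ hs]
  · rw [smul_apply, componentProj_apply_self hN hx hv]
  · intro c _ hc
    rw [smul_apply, hA.componentProj_apply_of_ne hN hx hc.symm hv, smul_zero]

theorem linearIndependent_componentProj :
    LinearIndependent ℂ fun c => (⟨componentProj c, hA.componentProj_mem_commutant c⟩ :
      commutant A) := by
  refine LinearIndependent.of_comp (commutant A).val.toLinearMap ?_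
  refine linearIndependent_iff'.mpr fun s f hf c hc => ?_
  induction c using SimpleGraph.ConnectedComponent.ind with
  | h x =>
    obtain ⟨N, hNx, hN⟩ := hA.exists_lowerJoin_ne_top x
    obtain ⟨v, hv, h0⟩ := exists_ne_zero_mem hNx
    have h := hA.sum_smul_componentProj_apply hN hNx hv s hc f
    have hz : (∑ c ∈ s, f c • componentProj c : H →L[ℂ] H) = 0 := hf
    rw [hz, zero_apply] at h
    exact (smul_eq_zero.mp h.symm).resolve_right h0

theorem rank_commutant_of_finite [Finite (latGraph A).ConnectedComponent] :
    Module.rank ℂ (commutant A) = Nat.card (latGraph A).ConnectedComponent := by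
  have := Fintype.ofFinite (latGraph A).ConnectedComponent
  have hspan : ⊤ ≤ Submodule.span ℂ (Set.range fun c =>
      (⟨componentProj c, hA.componentProj_mem_commutant c⟩ : commutant A)) := by
    rintro ⟨T, hT⟩ -
    obtain ⟨f, hf⟩ := hA.exists_component_scalar hT
    have : (⟨T, hT⟩ : commutant A) =
        ∑ c, f c • (⟨componentProj c, hA.componentProj_mem_commutant c⟩ : commutant A) := by
      refine Subtype.ext ?_
      rw [AddSubmonoidClass.coe_finsetSum]
      refine hA.operator_ext fun N hN v hv => ?_
      by_cases h0 : v = 0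
      · simp [h0]
      obtain ⟨x, hx⟩ := hA.exists_not_le_of_mem hv h0
      exact (hf N x hN hx v hv).trans
        (hA.sum_smul_componentProj_apply hN hx hv Finset.univ (Finset.mem_univ _) f).symm
    rw [this]
    exact Submodule.sum_mem _ fun c _ => Submodule.smul_mem _ _ (Submodule.subset_span ⟨c, rfl⟩)
  rw [rank_eq_card_basis (Module.Basis.mk hA.linearIndependent_componentProj hspan),
    Nat.card_eq_fintype_card]

theorem countable_connectedComponent [TopologicalSpace.SeparableSpace H] :
    Countable (latGraph A).ConnectedComponent := by
  have hex : ∀ c : (latGraph A).ConnectedComponent, ∃ x, (latGraph A).connectedComponentMk x = c ∧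
      ∃ N : lat A, ¬ N ≤ x.1 ∧ lowerJoin N ≠ ⊤ ∧ ∃ v ∈ N.1, ‖v‖ = 1 := fun c => by
    induction c using SimpleGraph.ConnectedComponent.ind with
    | h x =>
      obtain ⟨N, hNx, hN⟩ := hA.exists_lowerJoin_ne_top x
      obtain ⟨v, hv, h0⟩ := exists_ne_zero_mem hNx
      exact ⟨x, rfl, N, hNx, hN, _, SMulMemClass.smul_mem _ hv, norm_smul_inv_norm (𝕜 := ℂ) h0⟩
  choose x hx N hNx hN v hv h1 using hex
  have hdist : ∀ c d, c ≠ d → 1 ≤ dist (v c) (v d) := fun c d hcd => by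
    have h0 : inner ℂ (v c) (v d) = 0 := hA.inner_eq_zero (hN c) (hN d) (hNx c) (hNx d)
      (fun h => hcd (by rw [← hx c, ← hx d, SimpleGraph.ConnectedComponent.sound h])) (hv c) (hv d)
    -- Cauchy–Schwarz applied to `⟨v c, v c - v d⟩ = 1`; the balls of radius `1 / 2` are then
    -- disjoint.
    have := norm_inner_le_norm (𝕜 := ℂ) (v c) (v c - v d)
    rw [inner_sub_right, h0, inner_self_eq_norm_sq_to_K, h1] at this
    simpa [dist_eq_norm] using this
  refine Pairwise.countable_of_isOpen_disjoint (s := fun c => Metric.ball (v c) (1 / 2))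
    (fun c d hcd => Metric.ball_disjoint_ball ?_) (fun _ => Metric.isOpen_ball)
    fun c => ⟨v c, Metric.mem_ball_self (by norm_num)⟩
  linarith [hdist c d hcd]

end IsCDCSL

end OperatorAlgebra
end

/-! ### Comparison of the two counts -/

theorem proposition3p3 {H : Type*} [NormedAddCommGroup H] [InnerProductSpace ℂ H]
    [CompleteSpace H] [TopologicalSpace.SeparableSpace H]
    (A : Subalgebra ℂ (H →L[ℂ] H)) (hA : OperatorAlgebra.IsCDCSL A) :
    (∀ d : ℕ, Module.rank ℂ (OperatorAlgebra.commutant A) = d →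
      Nonempty (OperatorAlgebra.SpectralHomology A 0 ≃+ (Fin d → ℤ))) ∧
    (Cardinal.aleph0 ≤ Module.rank ℂ (OperatorAlgebra.commutant A) →
      Nonempty (OperatorAlgebra.SpectralHomology A 0 ≃+ (ℕ →₀ ℤ))) := by
  let C := (OperatorAlgebra.latGraph A).ConnectedComponent
  have e : OperatorAlgebra.SpectralHomology A 0 ≃+ (C →₀ ℤ) :=
    (PointNeighbourhood.homologyZeroEquiv (OperatorAlgebra.MeetIrr A)).toAddEquiv
  refine ⟨fun d hd => ?_, fun hinf => ?_⟩
  · have hfin : Finite C := by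
      have := hA.linearIndependent_componentProj.cardinal_le_rank
      rw [hd] at this
      exact Cardinal.lt_aleph0_iff_finite.mp (this.trans_lt Cardinal.natCast_lt_aleph0)
    have hcard : Nat.card C = d := by
      rw [hA.rank_commutant_of_finite] at hd
      exact_mod_cast hd
    have i : C ≃ Fin d := Finite.equivFinOfCardEq hcard
    exact ⟨e.trans ((Finsupp.domLCongr (R := ℤ) i).trans
      (Finsupp.linearEquivFunOnFinite ℤ ℤ (Fin d))).toAddEquiv⟩
  · have hC : Infinite C := by
      by_contra hfin
      rw [not_infinite_iff_finite] at hfin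
      rw [hA.rank_commutant_of_finite] at hinf
      exact absurd hinf (not_le.mpr Cardinal.natCast_lt_aleph0)
    have := hA.countable_connectedComponent
    obtain ⟨i⟩ := nonempty_equiv_of_countable (α := C) (β := ℕ)
    exact ⟨e.trans (Finsupp.domLCongr (R := ℤ) i).toAddEquiv⟩
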